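/- Let $p=p_n$ be a sequence of positive integers with $p_n\to\infty$ as $n\to\infty$. Let $\mathcal C_p$ be the set of all $p\times p$ covariance matrices, that is, symmetric nonnegative definite real matrices, and for $\tau>0$ let $\mathcal C_p(\tau)=\{\Sigma\in\mathcal C_p:\|\Sigma\|\le\tau\}$, where $\|\cdot\|$ is the spectral norm. Let $\|A\|_F^2=\sum_{i,j}a_{ij}^2$ be the squared Frobenius norm. For $\Sigma_0\in\mathcal C_p$ let $\mathbb E_{\Sigma_0}$ be the expectation when $\mathbf X_n=(X_1,\dots,X_n)$ is an i.i.d. sample from $N_p(0,\Sigma_0)$, and for a prior $\pi$ on $\mathcal C_p$ let $\mathbb E^{\pi}(\,\cdot\mid\mathbf X_n)$ be the expectation under the posterior distribution of $\Sigma$ given $\mathbf X_n$ in the model $X_1,\dots,X_n\mid\Sigma\overset{iid}{\sim}N_p(0,\Sigma)$. There is a constant $c>0$, depending neither on $n$ nor on the sequences $(p_n)$ and $(\tau_n)$, such that for every sequence $\tau=\tau_n>0$ (which may depend on $n$) and all sufficiently large $n$, $$\inf_{\pi}\ \sup_{\Sigma_0\in\mathcal C_p(\tau)}\mathbb E_{\Sigma_0}\,\mathbb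 E^{\pi}\bigl(\|\Sigma-\Sigma_0\|_F^2\mid\mathbf X_n\bigr)\ \ge\ c\,\tau^2\,\frac pn\,\min(p,\sqrt n),$$ where the infimum is over all priors $\pi$ on $\mathcal C_p$ (all probability measures, as well as all $\sigma$-finite improper priors with a proper posterior, and all versions of the posterior). The same lower bound holds for the frequentist minimax risk: $$\inf_{\hat\Sigma}\ \sup_{\Sigma_0\in\mathcal C_p(\tau)}\mathbb E_{\Sigma_0}\|\hat\Sigma-\Sigma_0\|_F^2\ \ge\ c\,\tau^2\,\frac pn\,\min(p,\sqrt n),$$ where the infimum is over all estimators $\hat\Sigma$, i.e. all measurable functions of $\mathbf X_n$ with values in the real $p\times p$ matrices. -/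

import Mathlib

open MeasureTheory ProbabilityTheory Filter
open scoped ENNReal

noncomputable section

namespace CovMinimax

/-- The Borel (entrywise) sigma-algebra on real `p × p` matrices. -/
instance instMeasurableSpaceMatrix (p : ℕ) : MeasurableSpace (Matrix (Fin p) (Fin p) ℝ) :=
  inferInstanceAs (MeasurableSpace (Fin p → Fin p → ℝ))

instance instBorelSpaceMatrix (p : ℕ) : BorelSpace (Matrix (Fin p) (Fin p) ℝ) :=
  inferInstanceAs (BorelSpace (Fin p → Fin p → ℝ))

/-- The parameter space: all `p × p` covariance matrices, i.e. all symmetric nonnegative definite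
real matrices, with the Borel sigma-algebra. -/
abbrev Cov (p : ℕ) : Type := {S : Matrix (Fin p) (Fin p) ℝ // S.PosSemidef}

/-- The sample space: `n` observations in `ℝ^p`. -/
abbrev Data (n p : ℕ) : Type := Fin n → EuclideanSpace ℝ (Fin p)

/-- The spectral norm `sup_{‖x‖₂ = 1} ‖A x‖₂`, i.e. the operator norm on Euclidean space. -/
def spectralNorm {p : ℕ} (A : Matrix (Fin p) (Fin p) ℝ) : ℝ :=
  ‖Matrix.toEuclideanCLM (n := Fin p) (𝕜 := ℝ) A‖

/-- The squared Frobenius norm. -/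
def frobSq {p : ℕ} (A : Matrix (Fin p) (Fin p) ℝ) : ℝ := ∑ i, ∑ j, A i j ^ 2

/-- The class `C(τ)` of covariance matrices with spectral norm at most `τ`. -/
def covClass (p : ℕ) (τ : ℝ) : Set (Cov p) := {S | spectralNorm S.1 ≤ τ}

/-- The law of an i.i.d. sample `X₁, …, Xₙ` from `N_p(0, S)`. -/
def sampleLaw (n p : ℕ) (S : Matrix (Fin p) (Fin p) ℝ) : Measure (Data n p) :=
  Measure.pi fun _ : Fin n => multivariateGaussian (0 : EuclideanSpace ℝ (Fin p)) S

section Measurability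

open scoped MatrixOrder Matrix.Norms.L2Operator

lemma continuous_sqrt_cov (p : ℕ) : Continuous fun S : Cov p => CFC.sqrt S.1 :=
  (CFC.continuousOn_sqrt (A := Matrix (Fin p) (Fin p) ℝ)).comp_continuous
    continuous_subtype_val fun S => S.2.nonneg

lemma measurable_sampleLaw (n p : ℕ) : Measurable fun S : Cov p => sampleLaw n p S.1 := by
  have hf : Measurable fun z : Cov p × Data n p => fun i : Fin n =>
      (0 : EuclideanSpace ℝ (Fin p)) +
        Matrix.toEuclideanCLM (n := Fin p) (𝕜 := ℝ) (CFC.sqrt z.1.1) (z.2 i) := by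
    refine measurable_pi_lambda _ fun i => ?_
    have h1 : Continuous fun w : Cov p × EuclideanSpace ℝ (Fin p) =>
        Matrix.toEuclideanCLM (n := Fin p) (𝕜 := ℝ) (CFC.sqrt w.1.1) w.2 := by
      have h0 : Continuous fun A : Matrix (Fin p) (Fin p) ℝ =>
          Matrix.toEuclideanCLM (n := Fin p) (𝕜 := ℝ) A :=
        LinearMap.continuous_of_finiteDimensional
          (Matrix.toEuclideanCLM (n := Fin p) (𝕜 := ℝ)).toAlgEquiv.toLinearMap
      exact (h0.comp ((continuous_sqrt_cov p).comp continuous_fst)).clm_apply continuous_snd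
    have h2 := h1.measurable.comp
      (measurable_fst.prodMk ((measurable_pi_apply i).comp measurable_snd) :
        Measurable fun z : Cov p × Data n p => (z.1, z.2 i))
    simpa using! h2
  have key : (fun S : Cov p => sampleLaw n p S.1) = fun S : Cov p =>
      (Measure.pi fun _ : Fin n => stdGaussian (EuclideanSpace ℝ (Fin p))).map fun x i =>
        (0 : EuclideanSpace ℝ (Fin p)) +
          Matrix.toEuclideanCLM (n := Fin p) (𝕜 := ℝ) (CFC.sqrt S.1) (x i) := by
    funext S
    have hm : Measurable fun y : EuclideanSpace ℝ (Fin p) => (0 : EuclideanSpace ℝ (Fin p)) +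
          Matrix.toEuclideanCLM (n := Fin p) (𝕜 := ℝ) (CFC.sqrt S.1) y := by fun_prop
    have : ∀ _ : Fin n, SigmaFinite ((stdGaussian (EuclideanSpace ℝ (Fin p))).map
        fun y => (0 : EuclideanSpace ℝ (Fin p)) +
          Matrix.toEuclideanCLM (n := Fin p) (𝕜 := ℝ) (CFC.sqrt S.1) y) := fun _ =>
      haveI := Measure.isProbabilityMeasure_map
        (μ := stdGaussian (EuclideanSpace ℝ (Fin p))) hm.aemeasurable
      inferInstance
    rw [Measure.pi_map_pi (fun _ => hm.aemeasurable)]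
    rfl
  rw [key]
  refine Measure.measurable_of_measurable_coe _ fun s hs => ?_
  have h3 := measurable_measure_prodMk_left (hf hs)
    (ν := Measure.pi fun _ : Fin n => stdGaussian (EuclideanSpace ℝ (Fin p)))
  convert h3 using 2 with S
  exact Measure.map_apply (hf.comp (measurable_prodMk_left (x := S))) hs

end Measurability

/-- The statistical model `X₁, …, Xₙ ∣ S ∼ N_p(0, S)` i.i.d., as a Markov kernel. -/
def model (n p : ℕ) : Kernel (Cov p) (Data n p) where
  toFun S := sampleLaw n p S.1
  measurable' := measurable_sampleLaw n p

/-- `κ` is a version of the posterior `π(· ∣ X₁, …, Xₙ)` of the prior `π` on covariance matrices: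
`κ` is a Markov kernel (the posterior is a probability measure for each data set) and
the joint law "draw `S` from `π`, then the data from the model" is recovered by drawing
the data from its marginal law and then the parameter from `κ`.
Every probability measure `π` is allowed, and so is every improper (infinite, sigma-finite)
prior whose posterior is proper. -/
structure IsPosterior (n p : ℕ) (π : Measure (Cov p)) (κ : Kernel (Data n p) (Cov p)) : Prop where
  prior_ne_zero : π ≠ 0
  prior_sigmaFinite : SigmaFinite π
  marginal_sigmaFinite : SigmaFinite (π.bind (model n p))
  isMarkov : IsMarkovKernel κ
  bayes : (π.bind (model n p)).compProd κ = (π.compProd (model n p)).map Prod.swap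

/-- The P-risk `E_{S₀} E^π (‖S - S₀‖_F² ∣ X₁, …, Xₙ)` at `S₀` of the posterior `κ`
(possibly infinite). -/
def pRisk {n p : ℕ} (κ : Kernel (Data n p) (Cov p)) (S₀ : Cov p) : ℝ≥0∞ :=
  ∫⁻ x, ∫⁻ S, ENNReal.ofReal (frobSq (S.1 - S₀.1)) ∂(κ x) ∂(sampleLaw n p S₀.1)

/-- The Bayesian minimax P-risk over `C(τ)`: the infimum over all priors (and all versions of
their posteriors) of the supremum of the P-risk over `C(τ)`. -/
def bayesMinimaxRisk (n p : ℕ) (τ : ℝ) : ℝ≥0∞ :=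
  ⨅ (π : Measure (Cov p)) (κ : Kernel (Data n p) (Cov p)) (_ : IsPosterior n p π κ),
    ⨆ S₀ ∈ covClass p τ, pRisk κ S₀

/-- The frequentist minimax risk over `C(τ)`: the infimum over all estimators (measurable
matrix-valued functions of the data) of the supremum over `C(τ)` of `E_{S₀} ‖Ŝ - S₀‖_F²`. -/
def freqMinimaxRisk (n p : ℕ) (τ : ℝ) : ℝ≥0∞ :=
  ⨅ (T : Data n p → Matrix (Fin p) (Fin p) ℝ) (_ : Measurable T),
    ⨆ S₀ ∈ covClass p τ, ∫⁻ x, ENNReal.ofReal (frobSq (T x - S₀.1)) ∂(sampleLaw n p S₀.1)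

end CovMinimax

end

/-! A posterior and an estimator both give a Markov kernel from the data to matrices, that is, a
randomized estimator. Both bounds therefore follow from one bound for such kernels, `le_iSup_risk`.

That bound is Assouad's method on the hypercube of covariances `s (1 + N)(1 + N)ᵀ` with `s = τ / 4`,
where `N` takes the values `0` or `ε = 1/√n` independently at the positions of a set `K` and
vanishes elsewhere. The row indices of `K` are disjoint from its column indices. Hence flipping one
bit multiplies the root `1 + N` on the right by a transvection (`patternRoot_flipAt`). A common
linear map then reduces each pair of neighbours to the standard Gaussian sample against its image
under a transvection, whose Kullback-Leibler divergence is `n ε² / 2 = 1/2` whatever the other bits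
are (`two_point_bound_sampleLaw`). So every bit costs a fixed multiple of `s² ε²`, which is of order
`τ² / n`.

Taking `K` to be a band of width about `min(p, √n)` keeps the spectral norm of `N` at most `1` and
provides of order `p · min(p, √n)` bits. -/

namespace CovMinimax

/-! ### Product densities and two-point testing. -/

/-- Integrable densities of product measures multiply. -/
theorem pi_withDensity_ofReal {ι : Type*} [Fintype ι] {X : ι → Type*} [∀ i, MeasurableSpace (X i)]
    (μ : ∀ i, Measure (X i)) [∀ i, SigmaFinite (μ i)] {f : ∀ i, X i → ℝ}
    (hf : ∀ i, Integrable (f i) (μ i)) (h0 : ∀ i x, 0 ≤ f i x) :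
    Measure.pi (fun i => (μ i).withDensity fun x => ENNReal.ofReal (f i x)) =
      (Measure.pi μ).withDensity fun x => ∏ i, ENNReal.ofReal (f i (x i)) := by
  have hfin : ∀ i, IsFiniteMeasure ((μ i).withDensity fun x => ENNReal.ofReal (f i x)) := fun i =>
    isFiniteMeasure_withDensity_ofReal (hf i).2
  refine Measure.pi_eq fun s hs => ?_
  have hi : ∀ i, Integrable ((s i).indicator (f i)) (μ i) := fun i => (hf i).indicator (hs i)
  have hi0 : ∀ i x, 0 ≤ (s i).indicator (f i) x := fun i x =>
    Set.indicator_nonneg (fun x _ => h0 i x) x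
  -- On a box the indicator factors over coordinates, so the mass of the box is a product of
  -- one-dimensional integrals by Fubini.
  have hpt : ∀ x, (Set.univ.pi s).indicator (fun x => ∏ i, ENNReal.ofReal (f i (x i))) x =
      ENNReal.ofReal (∏ i, (s i).indicator (f i) (x i)) := by
    intro x
    by_cases hx : x ∈ Set.univ.pi s
    · rw [Set.indicator_of_mem hx, ← ENNReal.ofReal_prod_of_nonneg fun i _ => h0 i _]
      congr 1
      exact Finset.prod_congr rfl fun i _ => (Set.indicator_of_mem (hx i trivial) _).symm
    · rw [Set.indicator_of_notMem hx]
      simp only [Set.mem_univ_pi, not_forall] at hx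
      obtain ⟨i, hi⟩ := hx
      rw [Finset.prod_eq_zero (Finset.mem_univ i) (Set.indicator_of_notMem hi _),
        ENNReal.ofReal_zero]
  rw [withDensity_apply _ (MeasurableSet.univ_pi hs),
    ← lintegral_indicator (MeasurableSet.univ_pi hs)]
  simp_rw [hpt]
  rw [← ofReal_integral_eq_lintegral_ofReal (Integrable.fintype_prod_dep hi)
      (ae_of_all _ fun x => Finset.prod_nonneg fun i _ => hi0 i _),
    integral_fintype_prod_eq_prod,
    ENNReal.ofReal_prod_of_nonneg fun i _ => integral_nonneg (hi0 i)]
  refine Finset.prod_congr rfl fun i _ => ?_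
  rw [withDensity_apply _ (hs i), integral_indicator (hs i),
    ofReal_integral_eq_lintegral_ofReal (hf i).integrableOn (ae_of_all _ (h0 i))]

/-- With `r = exp (h / 2)` and `h / 2 ≤ r - 1`, the two gaps are at least `(r - 2)² / 3` and `(2 r -
1)² / 3`. The left side is affine in `h` and `exp h`, so its integral involves only the divergence
and the total mass. -/
theorem min_one_exp_ge (h : ℝ) :
    4 / 3 * (1 + h / 2 - (1 + Real.exp h) / 4) ≤ min 1 (Real.exp h) := by
  have e1 := Real.add_one_le_exp (h / 2)
  have e2 : Real.exp h = Real.exp (h / 2) ^ 2 := by rw [← Real.exp_nat_mul]; congr 1; ring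
  rw [e2]
  have := Real.exp_pos (h / 2)
  set r := Real.exp (h / 2)
  refine le_min ?_ ?_
  · nlinarith [sq_nonneg (r - 2)]
  · nlinarith [sq_nonneg (2 * r - 1)]

/-- Two-point testing bound in terms of the Kullback-Leibler divergence. -/
theorem two_point_bound {Ω : Type*} [MeasurableSpace Ω] (P : Measure Ω) [IsProbabilityMeasure P]
    {h : Ω → ℝ} (hm : Measurable h) (hint : Integrable h P)
    (hprob : IsProbabilityMeasure (P.withDensity fun x => ENNReal.ofReal (Real.exp (h x))))
    (hKL : -(1 / 2) ≤ ∫ x, h x ∂P) {a b : Ω → ℝ≥0∞} (ha : Measurable a) (hb : Measurable b)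
    {C : ℝ≥0∞} (hC : ∀ x, C ≤ a x + b x) :
    C * ENNReal.ofReal (1 / 3) ≤ ∫⁻ x, a x ∂P +
      ∫⁻ x, b x ∂(P.withDensity fun x => ENNReal.ofReal (Real.exp (h x))) := by
  have hem : Measurable fun x => ENNReal.ofReal (Real.exp (h x)) := by fun_prop
  have h1 : ∫⁻ x, ENNReal.ofReal (Real.exp (h x)) ∂P = 1 := by
    have := hprob.measure_univ
    rwa [withDensity_apply _ MeasurableSet.univ, Measure.restrict_univ] at this
  have hei : Integrable (fun x => Real.exp (h x)) P := by
    refine (lintegral_ofReal_ne_top_iff_integrable (by fun_prop)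
      (ae_of_all _ fun x => (Real.exp_pos _).le)).1 ?_
    simp [h1]
  have he1 : ∫ x, Real.exp (h x) ∂P = 1 := by
    rw [integral_eq_lintegral_of_nonneg_ae (ae_of_all _ fun x => (Real.exp_pos _).le)
      (by fun_prop), h1, ENNReal.toReal_one]
  -- Integrating the pointwise bound gives `4/3 · (1 - 1/4 - 1/2) = 1/3`.
  have hmin : 1 / 3 ≤ ∫ x, min 1 (Real.exp (h x)) ∂P := by
    have hl : Integrable (fun x => 4 / 3 * (1 + h x / 2 - (1 + Real.exp (h x)) / 4)) P :=
      (((integrable_const _).add (hint.div_const _)).sub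
        (((integrable_const _).add hei).div_const _)).const_mul _
    calc (1 / 3 : ℝ) ≤ ∫ x, 4 / 3 * (1 + h x / 2 - (1 + Real.exp (h x)) / 4) ∂P := by
          have e1 : ∫ x, (1 + h x / 2) ∂P = 1 + (∫ x, h x ∂P) / 2 := by
            rw [integral_add (integrable_const _) (hint.div_const _), integral_div]
            simp
          have e2 : ∫ x, (1 + Real.exp (h x)) / 4 ∂P = 1 / 2 := by
            rw [integral_div, integral_add (integrable_const _) hei, he1]
            norm_num
          have e3 : ∫ x, ((1 + h x / 2) - (1 + Real.exp (h x)) / 4) ∂P =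
              ∫ x, (1 + h x / 2) ∂P - ∫ x, (1 + Real.exp (h x)) / 4 ∂P :=
            integral_sub ((integrable_const _).add (hint.div_const _))
              (((integrable_const _).add hei).div_const _)
          rw [integral_const_mul, e3, e1, e2]
          linarith
      _ ≤ _ := integral_mono hl ((integrable_const _).inf hei) fun x => min_one_exp_ge (h x)
  rw [lintegral_withDensity_eq_lintegral_mul _ hem hb, ← lintegral_add_left ha]
  calc C * ENNReal.ofReal (1 / 3)
      ≤ C * ∫⁻ x, ENNReal.ofReal (min 1 (Real.exp (h x))) ∂P := by
        rw [← ofReal_integral_eq_lintegral_ofReal (f := fun x => min 1 (Real.exp (h x)))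
          ((integrable_const _).inf hei) (ae_of_all _ fun x => le_min zero_le_one (Real.exp_pos _).le)]
        gcongr
    _ = ∫⁻ x, C * ENNReal.ofReal (min 1 (Real.exp (h x))) ∂P :=
        (lintegral_const_mul _ (by fun_prop)).symm
    _ ≤ _ := lintegral_mono fun x => by
        calc C * ENNReal.ofReal (min 1 (Real.exp (h x)))
            ≤ (a x + b x) * ENNReal.ofReal (min 1 (Real.exp (h x))) := by gcongr; exact hC x
          _ ≤ a x + ENNReal.ofReal (Real.exp (h x)) * b x := by
            rw [add_mul, mul_comm (b x)]
            gcongr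
            · exact mul_le_of_le_one_right' (by simp)
            · exact min_le_right _ _

/-! ### Likelihood ratio of a transvected standard Gaussian. -/

section Transvection

variable {ι : Type*}

/-- The log-likelihood ratio of a Gaussian vector transformed by a transvection. -/
noncomputable def logRatio (i j : ι) (δ : ℝ) (x : EuclideanSpace ℝ ι) : ℝ := δ * (x i * x j) - δ ^ 2 / 2 * x j ^ 2

theorem measurable_logRatio (i j : ι) (δ : ℝ) : Measurable (logRatio i j δ) := by
  unfold logRatio; fun_prop

variable [Fintype ι]

theorem pi_gaussianReal_eq_withDensity :
    Measure.pi (fun _ : ι => gaussianReal 0 1) = (volume : Measure (ι → ℝ)).withDensity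
      fun x => ∏ i, gaussianPDF 0 1 (x i) := by
  rw [volume_pi]
  refine Eq.trans ?_ (pi_withDensity_ofReal (fun _ : ι => (volume : Measure ℝ))
    (f := fun _ => gaussianPDFReal 0 1) (fun _ => integrable_gaussianPDFReal 0 1)
    fun _ => gaussianPDFReal_nonneg 0 1)
  congr 1
  funext i
  exact gaussianReal_of_var_ne_zero 0 one_ne_zero

theorem prod_gaussianPDF (x : ι → ℝ) : ∏ i, gaussianPDF 0 1 (x i) =
    ENNReal.ofReal ((∏ _i : ι, (Real.sqrt (2 * Real.pi))⁻¹) * Real.exp (- (∑ i, x i ^ 2) / 2)) := by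
  simp_rw [gaussianPDF, gaussianPDFReal]
  rw [← ENNReal.ofReal_prod_of_nonneg fun i _ => by positivity, Finset.prod_mul_distrib,
    ← Real.exp_sum]
  simp [Finset.sum_neg_distrib, Finset.sum_div, neg_div]

theorem integrable_logRatio (i j : ι) (δ : ℝ) :
    Integrable (logRatio i j δ) (stdGaussian (EuclideanSpace ℝ ι)) := by
  have h2 : ∀ k, MemLp (fun x : EuclideanSpace ℝ ι => x k) 2 (stdGaussian (EuclideanSpace ℝ ι)) :=
    fun k => (IsGaussian.memLp_dual _ (EuclideanSpace.proj k : _ →L[ℝ] ℝ) 2 (by simp))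
  exact (((h2 i).integrable_mul (h2 j)).const_mul δ).sub ((h2 j).integrable_sq.const_mul _)

variable [DecidableEq ι]

theorem map_transvection_pi_gaussianReal {i j : ι} (hij : i ≠ j) (δ : ℝ) :
    (Measure.pi (fun _ : ι => gaussianReal 0 1)).map
        (Matrix.toLin' (Matrix.transvection i j δ)) =
      (Measure.pi (fun _ : ι => gaussianReal 0 1)).withDensity
        fun x => ENNReal.ofReal (Real.exp (logRatio i j δ (WithLp.toLp 2 x))) := by
  have hU : Measurable (Matrix.toLin' (Matrix.transvection i j δ)) :=
    (LinearMap.continuous_of_finiteDimensional _).measurable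
  have hlog : Measurable fun x : ι → ℝ =>
      ENNReal.ofReal (Real.exp (logRatio i j δ (WithLp.toLp 2 x))) := by
    unfold logRatio; fun_prop
  have hρ : Measurable fun x : ι → ℝ => ∏ i, gaussianPDF 0 1 (x i) :=
    Finset.measurable_prod _ fun i _ => (measurable_gaussianPDF 0 1).comp (measurable_pi_apply i)
  -- A transvection has determinant `1`, so the change of variables has no Jacobian factor and the
  -- ratio is a quotient of Gaussian densities.
  have hpres : MeasurePreserving (Matrix.toLin' (Matrix.transvection i j δ)) :=
    Real.volume_preserving_transvectionStruct ⟨i, j, hij, δ⟩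
  have key : ∀ x : ι → ℝ, ∏ k, gaussianPDF 0 1 (x k) =
      (∏ k, gaussianPDF 0 1 (Matrix.toLin' (Matrix.transvection i j δ) x k)) *
      ENNReal.ofReal (Real.exp (logRatio i j δ
        (WithLp.toLp 2 (Matrix.toLin' (Matrix.transvection i j δ) x)))) := by
    intro x
    have hUx : Matrix.toLin' (Matrix.transvection i j δ) x = x + Pi.single i (δ * x j) := by
      rw [Matrix.toLin'_apply, Matrix.transvection, Matrix.add_mulVec, Matrix.one_mulVec,
        Matrix.single_mulVec]
      rfl
    rw [prod_gaussianPDF, prod_gaussianPDF, ← ENNReal.ofReal_mul (by positivity), mul_assoc,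
      ← Real.exp_add, hUx]
    congr 3
    have hs : ∑ k, (x + Pi.single i (δ * x j) : ι → ℝ) k ^ 2 = ∑ k, x k ^ 2 +
        (2 * x i * (δ * x j) + (δ * x j) ^ 2) := by
      have : ∀ k, (x + Pi.single i (δ * x j) : ι → ℝ) k ^ 2 = x k ^ 2 +
          if k = i then (2 * x i * (δ * x j) + (δ * x j) ^ 2) else 0 := by
        intro k
        by_cases hk : k = i
        · subst hk; simp; ring
        · simp [hk]
      simp_rw [this, Finset.sum_add_distrib]
      simp
    rw [hs]
    simp [logRatio, hij.symm]
    ring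
  refine Measure.ext_of_lintegral _ fun f hf => ?_
  rw [lintegral_map hf hU, lintegral_withDensity_eq_lintegral_mul _ hlog hf,
    pi_gaussianReal_eq_withDensity,
    lintegral_withDensity_eq_lintegral_mul _ hρ
      (show Measurable fun x => f (Matrix.toLin' (Matrix.transvection i j δ) x) from hf.comp hU),
    lintegral_withDensity_eq_lintegral_mul _ hρ (hlog.mul hf),
    ← hpres.lintegral_comp (hρ.mul (hlog.mul hf))]
  refine lintegral_congr fun x => ?_
  simp only [Pi.mul_apply]
  rw [key x, mul_assoc]

theorem map_transvection_stdGaussian {i j : ι} (hij : i ≠ j) (δ : ℝ) :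
    (stdGaussian (EuclideanSpace ℝ ι)).map
        (Matrix.toEuclideanCLM (n := ι) (𝕜 := ℝ) (Matrix.transvection i j δ)) =
      (stdGaussian (EuclideanSpace ℝ ι)).withDensity
        fun x => ENNReal.ofReal (Real.exp (logRatio i j δ x)) := by
  have hlog := (measurable_logRatio i j δ).exp.ennreal_ofReal
  have hT : Measurable (WithLp.toLp 2 : (ι → ℝ) → EuclideanSpace ℝ ι) := by fun_prop
  have hU : Measurable (Matrix.toLin' (Matrix.transvection i j δ)) :=
    (LinearMap.continuous_of_finiteDimensional _).measurable
  rw [← map_pi_eq_stdGaussian, Measure.map_map (by fun_prop) hT]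
  have : (Matrix.toEuclideanCLM (n := ι) (𝕜 := ℝ) (Matrix.transvection i j δ)) ∘
      (WithLp.toLp 2 : (ι → ℝ) → EuclideanSpace ℝ ι) =
      WithLp.toLp 2 ∘ Matrix.toLin' (Matrix.transvection i j δ) := by
    ext x; simp
  rw [this, ← Measure.map_map hT hU, map_transvection_pi_gaussianReal hij]
  refine Measure.ext_of_lintegral _ fun f hf => ?_
  rw [lintegral_map hf hT, lintegral_withDensity_eq_lintegral_mul _
      (show Measurable fun x : ι → ℝ =>
        ENNReal.ofReal (Real.exp (logRatio i j δ (WithLp.toLp 2 x))) from hlog.comp hT)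
      (show Measurable fun x : ι → ℝ => f (WithLp.toLp 2 x) from hf.comp hT),
    lintegral_withDensity_eq_lintegral_mul _ hlog hf, lintegral_map (hlog.mul hf) hT]
  rfl

/-- Distinct coordinates are uncorrelated, so only the quadratic term survives: the divergence per
observation is `δ² / 2`. -/
theorem integral_logRatio {i j : ι} (hij : i ≠ j) (δ : ℝ) :
    ∫ x, logRatio i j δ x ∂(stdGaussian (EuclideanSpace ℝ ι)) = - (δ ^ 2 / 2) := by
  have h2 : ∀ k, MemLp (fun x : EuclideanSpace ℝ ι => x k) 2 (stdGaussian (EuclideanSpace ℝ ι)) :=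
    fun k => (IsGaussian.memLp_dual _ (EuclideanSpace.proj k : _ →L[ℝ] ℝ) 2 (by simp))
  have h0 : ∀ k, ∫ x : EuclideanSpace ℝ ι, x k ∂(stdGaussian (EuclideanSpace ℝ ι)) = 0 :=
    fun k => integral_strongDual_stdGaussian (EuclideanSpace.proj k : _ →L[ℝ] ℝ)
  have hc : ∀ k l, ∫ x : EuclideanSpace ℝ ι, x k * x l ∂(stdGaussian (EuclideanSpace ℝ ι)) =
      (1 : Matrix ι ι ℝ) k l := by
    intro k l
    have := covariance_eval_multivariateGaussian (μ := (0 : EuclideanSpace ℝ ι))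
      (S := (1 : Matrix ι ι ℝ)) Matrix.PosSemidef.one k l
    rw [multivariateGaussian_zero_one, covariance_eq_sub (h2 k) (h2 l), h0, h0] at this
    simpa using this
  unfold logRatio
  have e : ∫ x : EuclideanSpace ℝ ι, (δ * (x i * x j) - δ ^ 2 / 2 * x j ^ 2)
        ∂(stdGaussian (EuclideanSpace ℝ ι)) =
      ∫ x : EuclideanSpace ℝ ι, δ * (x i * x j) ∂(stdGaussian (EuclideanSpace ℝ ι)) -
      ∫ x : EuclideanSpace ℝ ι, δ ^ 2 / 2 * x j ^ 2 ∂(stdGaussian (EuclideanSpace ℝ ι)) :=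
    integral_sub (((h2 i).integrable_mul (h2 j)).const_mul δ) ((h2 j).integrable_sq.const_mul _)
  have hsq : ∀ x : EuclideanSpace ℝ ι, x j ^ 2 = x j * x j := fun x => pow_two _
  simp_rw [e, integral_const_mul, hsq, hc]
  simp [hij]

end Transvection

/-! ### Testing with `n` independent observations. -/

section TwoPoint

variable {ι : Type*} [Fintype ι] {n : ℕ} {i j : ι}

theorem measurePreserving_eval_stdGaussian (k : Fin n) :
    MeasurePreserving (fun x : Fin n → EuclideanSpace ℝ ι => x k)
      (Measure.pi fun _ : Fin n => stdGaussian (EuclideanSpace ℝ ι))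
      (stdGaussian (EuclideanSpace ℝ ι)) :=
  measurePreserving_eval (fun _ : Fin n => stdGaussian (EuclideanSpace ℝ ι)) k

theorem integrable_logRatio_eval (i j : ι) (δ : ℝ) (k : Fin n) :
    Integrable (fun x : Fin n → EuclideanSpace ℝ ι => logRatio i j δ (x k))
      (Measure.pi fun _ : Fin n => stdGaussian (EuclideanSpace ℝ ι)) :=
  (measurePreserving_eval_stdGaussian k).integrable_comp_of_integrable (integrable_logRatio i j δ)

variable [DecidableEq ι]

instance isProbabilityMeasure_map_toEuclideanCLM (A : Matrix ι ι ℝ) :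
    IsProbabilityMeasure ((stdGaussian (EuclideanSpace ℝ ι)).map
      (Matrix.toEuclideanCLM (n := ι) (𝕜 := ℝ) A)) :=
  Measure.isProbabilityMeasure_map (by fun_prop)

theorem integrable_exp_logRatio (hij : i ≠ j) (δ : ℝ) :
    Integrable (fun x => Real.exp (logRatio i j δ x)) (stdGaussian (EuclideanSpace ℝ ι)) := by
  refine (lintegral_ofReal_ne_top_iff_integrable
    (measurable_logRatio i j δ).exp.aestronglyMeasurable
    (ae_of_all _ fun x => (Real.exp_pos _).le)).1 ?_
  -- The integral of the likelihood ratio is the total mass of the image law.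
  have := (isProbabilityMeasure_map_toEuclideanCLM (Matrix.transvection i j δ)).measure_univ
  rw [map_transvection_stdGaussian hij, withDensity_apply _ MeasurableSet.univ,
    Measure.restrict_univ] at this
  simp [this]

theorem pi_map_transvection_stdGaussian (hij : i ≠ j) (δ : ℝ) :
    (Measure.pi fun _ : Fin n => (stdGaussian (EuclideanSpace ℝ ι)).map
        (Matrix.toEuclideanCLM (n := ι) (𝕜 := ℝ) (Matrix.transvection i j δ))) =
      (Measure.pi fun _ : Fin n => stdGaussian (EuclideanSpace ℝ ι)).withDensity
        fun x => ENNReal.ofReal (Real.exp (∑ k, logRatio i j δ (x k))) := by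
  rw [map_transvection_stdGaussian hij,
    pi_withDensity_ofReal (fun _ => stdGaussian (EuclideanSpace ℝ ι))
      (fun _ => integrable_exp_logRatio hij δ) fun _ x => (Real.exp_pos _).le]
  congr 1
  funext x
  rw [Real.exp_sum, ENNReal.ofReal_prod_of_nonneg fun _ _ => (Real.exp_pos _).le]

theorem integral_logRatio_eval (hij : i ≠ j) (δ : ℝ) (k : Fin n) :
    ∫ x : Fin n → EuclideanSpace ℝ ι, logRatio i j δ (x k)
      ∂(Measure.pi fun _ : Fin n => stdGaussian (EuclideanSpace ℝ ι)) = - (δ ^ 2 / 2) := by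
  have h := measurePreserving_eval_stdGaussian (ι := ι) k
  rw [← integral_logRatio hij δ]
  conv_rhs => rw [← h.map_eq]
  exact (integral_map h.measurable.aemeasurable
    (measurable_logRatio i j δ).aestronglyMeasurable).symm

/-- Log-likelihood ratios add over the sample, so the divergence is `n δ² / 2 ≤ 1/2`, as
`two_point_bound` requires. -/
theorem two_point_bound_gaussian (hij : i ≠ j) {δ : ℝ} (hδ : n * δ ^ 2 ≤ 1)
    {a b : (Fin n → EuclideanSpace ℝ ι) → ℝ≥0∞}
    (ha : Measurable a) (hb : Measurable b) {C : ℝ≥0∞} (hC : ∀ x, C ≤ a x + b x) :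
    C * ENNReal.ofReal (1 / 3) ≤
      ∫⁻ x, a x ∂(Measure.pi fun _ : Fin n => stdGaussian (EuclideanSpace ℝ ι)) +
      ∫⁻ x, b x ∂(Measure.pi fun _ : Fin n => (stdGaussian (EuclideanSpace ℝ ι)).map
        (Matrix.toEuclideanCLM (n := ι) (𝕜 := ℝ) (Matrix.transvection i j δ))) := by
  have hden := pi_map_transvection_stdGaussian (n := n) hij δ
  have hm : Measurable fun x : Fin n → EuclideanSpace ℝ ι => ∑ k, logRatio i j δ (x k) :=
    Finset.measurable_sum _ fun k _ => (measurable_logRatio i j δ).comp (measurable_pi_apply k)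
  have hKL : -(1 / 2) ≤ ∫ x : Fin n → EuclideanSpace ℝ ι, ∑ k, logRatio i j δ (x k)
      ∂(Measure.pi fun _ : Fin n => stdGaussian (EuclideanSpace ℝ ι)) := by
    rw [integral_finsetSum _ fun k _ => integrable_logRatio_eval i j δ k]
    simp_rw [integral_logRatio_eval hij]
    simp
    linarith
  have hint := integrable_finsetSum (Finset.univ : Finset (Fin n))
    fun k _ => integrable_logRatio_eval i j δ k
  have hprob : IsProbabilityMeasure
      ((Measure.pi fun _ : Fin n => stdGaussian (EuclideanSpace ℝ ι)).withDensity
        fun x => ENNReal.ofReal (Real.exp (∑ k, logRatio i j δ (x k)))) := by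
    rw [← hden]; infer_instance
  rw [hden]
  exact two_point_bound _ hm hint hprob hKL ha hb hC

end TwoPoint

/-! ### Transport to a general covariance by an arbitrary root. -/

/-- Any root `A` of the covariance may replace the positive semidefinite one: the characteristic
function sees `A` only through `‖Aᵀ t‖² = tᵀ A Aᵀ t`. The nonsymmetric roots `√s (1 + N)` need this.
-/
theorem multivariateGaussian_mul_conjTranspose {ι : Type*} [Fintype ι] [DecidableEq ι]
    (A : Matrix ι ι ℝ) :
    multivariateGaussian 0 (A * A.conjTranspose) =
      (stdGaussian (EuclideanSpace ℝ ι)).map (Matrix.toEuclideanCLM (n := ι) (𝕜 := ℝ) A) := by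
  refine Measure.ext_of_charFun ?_
  ext t
  have h1 : charFun ((stdGaussian (EuclideanSpace ℝ ι)).map
      (Matrix.toEuclideanCLM (n := ι) (𝕜 := ℝ) A)) t =
      charFun (stdGaussian (EuclideanSpace ℝ ι))
        (Matrix.toEuclideanCLM (n := ι) (𝕜 := ℝ) A.conjTranspose t) := by
    rw [charFun_apply, charFun_apply, integral_map (by fun_prop) (by fun_prop)]
    refine integral_congr_ae (ae_of_all _ fun x => ?_)
    have : inner ℝ (Matrix.toEuclideanCLM (n := ι) (𝕜 := ℝ) A x) t =
        inner ℝ x (Matrix.toEuclideanCLM (n := ι) (𝕜 := ℝ) A.conjTranspose t) := by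
      rw [← Matrix.star_eq_conjTranspose, map_star, ContinuousLinearMap.star_eq_adjoint,
        ContinuousLinearMap.adjoint_inner_right]
    simp only [this]
  have h2 : ‖Matrix.toEuclideanCLM (n := ι) (𝕜 := ℝ) A.conjTranspose t‖ ^ 2 =
      t.ofLp ⬝ᵥ (A * A.conjTranspose).mulVec t.ofLp := by
    rw [EuclideanSpace.real_norm_sq_eq, ← Matrix.mulVec_mulVec, Matrix.dotProduct_mulVec,
      dotProduct]
    refine Finset.sum_congr rfl fun i _ => ?_
    rw [pow_two]
    congr 1
    simp [Matrix.mulVec_transpose, Matrix.conjTranspose_eq_transpose_of_trivial]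
  rw [h1, charFun_stdGaussian,
    charFun_multivariateGaussian (Matrix.posSemidef_self_mul_conjTranspose A), ← h2]
  simp [neg_div]

theorem sampleLaw_mul_conjTranspose (n : ℕ) {p : ℕ} (A : Matrix (Fin p) (Fin p) ℝ) :
    sampleLaw n p (A * A.conjTranspose) = Measure.pi fun _ : Fin n =>
      (stdGaussian (EuclideanSpace ℝ (Fin p))).map
        (Matrix.toEuclideanCLM (n := Fin p) (𝕜 := ℝ) A) := by
  simp_rw [sampleLaw, multivariateGaussian_mul_conjTranspose]

/-- Testing between two Gaussian samples whose square-root covariances differ by a transvection. -/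
theorem two_point_bound_sampleLaw {n p : ℕ} (A : Matrix (Fin p) (Fin p) ℝ) {i j : Fin p}
    (hij : i ≠ j) {δ : ℝ} (hδ : n * δ ^ 2 ≤ 1) {a b : Data n p → ℝ≥0∞}
    (ha : Measurable a) (hb : Measurable b) {C : ℝ≥0∞} (hC : ∀ x, C ≤ a x + b x) :
    C * ENNReal.ofReal (1 / 3) ≤ ∫⁻ x, a x ∂(sampleLaw n p (A * A.conjTranspose)) +
      ∫⁻ x, b x ∂(sampleLaw n p ((A * Matrix.transvection i j δ) *
        (A * Matrix.transvection i j δ).conjTranspose)) := by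
  set U := Matrix.toEuclideanCLM (n := Fin p) (𝕜 := ℝ) (Matrix.transvection i j δ)
  set T := Matrix.toEuclideanCLM (n := Fin p) (𝕜 := ℝ) A
  -- Both sample laws are images under the observationwise map `T`, one of the standard sample and
  -- one of the transvected sample, so the test pulls back along it.
  have hΦ : Measurable fun (x : Data n p) k => T (x k) := by fun_prop
  rw [sampleLaw_mul_conjTranspose, sampleLaw_mul_conjTranspose, map_mul,
    ContinuousLinearMap.mul_def, ContinuousLinearMap.coe_comp, ← Measure.map_map (by fun_prop) (by fun_prop),
    ← Measure.pi_map_pi fun _ => by fun_prop, ← Measure.pi_map_pi fun _ => by fun_prop,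
    lintegral_map ha hΦ, lintegral_map hb hΦ]
  exact two_point_bound_gaussian hij hδ (ha.comp hΦ) (hb.comp hΦ) fun x => hC _

/-! ### The hypercube of covariances and Assouad's lemma. -/

section Pattern


variable {p : ℕ}

/-- The matrix with entry `ε` at the positions of `K` selected by `θ`, and `0` elsewhere. -/
noncomputable def patternMatrix (K : Finset (Fin p × Fin p)) (ε : ℝ) (θ : Fin p × Fin p → Bool) :
    Matrix (Fin p) (Fin p) ℝ := Matrix.of fun i j => if (i, j) ∈ K ∧ θ (i, j) then ε else 0

/-- The square root `√s (1 + N)` of the covariance matrix attached to the pattern `N`. -/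
noncomputable def patternRoot (K : Finset (Fin p × Fin p)) (ε s : ℝ) (θ : Fin p × Fin p → Bool) :
    Matrix (Fin p) (Fin p) ℝ := Real.sqrt s • (1 + patternMatrix K ε θ)

/-- The covariance matrix `s (1 + N) (1 + N)ᴴ` attached to the pattern `N`. -/
noncomputable def patternCov (K : Finset (Fin p × Fin p)) (ε s : ℝ) (θ : Fin p × Fin p → Bool) : Cov p :=
  ⟨patternRoot K ε s θ * (patternRoot K ε s θ).conjTranspose,
    Matrix.posSemidef_self_mul_conjTranspose _⟩

/-- Reverse the bit of `θ` at `e`. -/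
def flipAt (e : Fin p × Fin p) (θ : Fin p × Fin p → Bool) : Fin p × Fin p → Bool :=
  Function.update θ e (!θ e)

theorem flipAt_involutive (e : Fin p × Fin p) : Function.Involutive (flipAt e) := by
  intro θ
  simp [flipAt]

variable {K : Finset (Fin p × Fin p)} {ε s : ℝ} {θ : Fin p × Fin p → Bool}

theorem patternMatrix_of_notMem {i j : Fin p} (h : (i, j) ∉ K) : patternMatrix K ε θ i j = 0 := by
  simp [patternMatrix, h]

theorem patternMatrix_flipAt {i j : Fin p} (h : (i, j) ∈ K) :
    patternMatrix K ε (flipAt (i, j) θ) =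
      patternMatrix K ε θ + Matrix.single i j (if θ (i, j) then -ε else ε) := by
  ext k l
  by_cases hkl : (k, l) = (i, j)
  · obtain ⟨rfl, rfl⟩ := Prod.mk.inj hkl
    by_cases hθ : θ (k, l) <;> simp [patternMatrix, flipAt, h, hθ]
  · have : ¬ (i = k ∧ j = l) := fun ⟨a, b⟩ => hkl (by rw [a, b])
    simp [patternMatrix, flipAt, Function.update_of_ne hkl, this]

/-- Column `i` of `N` vanishes when `(i, j) ∈ K`, so `N` annihilates the matrix unit at `(i, j)` and
`(1 + N)(1 + c E) = 1 + N + c E`. -/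
theorem patternRoot_flipAt (hK : ∀ i j k, (i, j) ∈ K → (j, k) ∉ K) {i j : Fin p}
    (h : (i, j) ∈ K) :
    patternRoot K ε s (flipAt (i, j) θ) =
      patternRoot K ε s θ * Matrix.transvection i j (if θ (i, j) then -ε else ε) := by
  have h0 : ∀ c, patternMatrix K ε θ * Matrix.single i j c = 0 := by
    intro c
    ext k l
    rw [Matrix.mul_apply]
    refine Finset.sum_eq_zero fun q _ => ?_
    by_cases hq : i = q
    · subst hq
      rw [patternMatrix_of_notMem fun hki => hK k i j hki h, zero_mul]
    · simp [hq]
  simp only [patternRoot, patternMatrix_flipAt h, Matrix.transvection, smul_mul_assoc, add_mul,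
    mul_add, one_mul, mul_one, h0, smul_add, add_assoc, smul_zero, add_zero]

/-- In `1 + N + Nᵀ + N Nᵀ` only `N` contributes at a position `(i, j)` of `K`, because row `j` of
`N` is zero. Each bit can thus be read off its own entry of the covariance. -/
theorem patternCov_apply (hK : ∀ i j k, (i, j) ∈ K → (j, k) ∉ K) (hs : 0 ≤ s) {i j : Fin p}
    (h : (i, j) ∈ K) : (patternCov K ε s θ).1 i j = s * patternMatrix K ε θ i j := by
  have hij : i ≠ j := by rintro rfl; exact hK _ _ _ h h
  have h1 : patternMatrix K ε θ j i = 0 := patternMatrix_of_notMem (hK i j i h)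
  have h2 : (patternMatrix K ε θ * (patternMatrix K ε θ).conjTranspose) i j = 0 := by
    rw [Matrix.mul_apply]
    refine Finset.sum_eq_zero fun k _ => ?_
    rw [Matrix.conjTranspose_apply, patternMatrix_of_notMem (hK i j k h)]
    simp
  simp only [patternCov, patternRoot, Matrix.conjTranspose_smul, star_trivial, smul_mul_assoc,
    mul_smul_comm, Matrix.conjTranspose_add,
    Matrix.conjTranspose_one, add_mul, mul_add, one_mul, mul_one, Matrix.smul_apply,
    Matrix.add_apply, h2, Matrix.conjTranspose_apply, h1, Matrix.one_apply_ne hij, smul_eq_mul]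
  linear_combination patternMatrix K ε θ i j * Real.mul_self_sqrt hs

/-- Schur's test for a pattern matrix. -/
theorem spectralNorm_patternMatrix_le {m : ℕ} (hε : 0 ≤ ε)
    (hrow : ∀ i, (Finset.univ.filter fun j => (i, j) ∈ K).card ≤ m)
    (hcol : ∀ j, (Finset.univ.filter fun i => (i, j) ∈ K).card ≤ m) :
    spectralNorm (patternMatrix K ε θ) ≤ m * ε := by
  refine ContinuousLinearMap.opNorm_le_bound _ (by positivity) fun x => ?_
  refine abs_le_of_sq_le_sq' ?_ (by positivity) |>.2
  rw [mul_pow, EuclideanSpace.real_norm_sq_eq, EuclideanSpace.real_norm_sq_eq]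
  -- Cauchy-Schwarz over the at most `m` positions in row `i`; the column bound enters on summing
  -- over `i`.
  have hle : ∀ i, (Matrix.toEuclideanCLM (n := Fin p) (𝕜 := ℝ) (patternMatrix K ε θ) x) i ^ 2 ≤
      m * ε ^ 2 * ∑ j, if (i, j) ∈ K then x j ^ 2 else 0 := by
    intro i
    have e1 : (Matrix.toEuclideanCLM (n := Fin p) (𝕜 := ℝ) (patternMatrix K ε θ) x) i =
        ∑ j ∈ Finset.univ.filter fun j => (i, j) ∈ K, patternMatrix K ε θ i j * x j := by
      rw [Matrix.ofLp_toEuclideanCLM, Matrix.mulVec, dotProduct, Finset.sum_filter]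
      refine Finset.sum_congr rfl fun j _ => ?_
      split_ifs with hj
      · rfl
      · rw [patternMatrix_of_notMem hj, zero_mul]
    rw [e1, ← Finset.sum_filter, mul_assoc, Finset.mul_sum]
    refine sq_sum_le_card_mul_sum_sq.trans ?_
    refine mul_le_mul (by exact_mod_cast hrow i) ?_
      (Finset.sum_nonneg fun _ _ => sq_nonneg _) (by positivity)
    refine Finset.sum_le_sum fun j _ => ?_
    rw [mul_pow]
    refine mul_le_mul_of_nonneg_right ?_ (sq_nonneg _)
    simp only [patternMatrix, Matrix.of_apply]
    split_ifs
    · rfl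
    · simpa using sq_nonneg ε
  calc _ ≤ ∑ i, m * ε ^ 2 * ∑ j, (if (i, j) ∈ K then x j ^ 2 else 0) :=
        Finset.sum_le_sum fun i _ => hle i
    _ = m * ε ^ 2 * ∑ j, ∑ i, (if (i, j) ∈ K then x j ^ 2 else 0) := by
        rw [← Finset.mul_sum, Finset.sum_comm]
    _ ≤ m * ε ^ 2 * ∑ j, m * x j ^ 2 := by
        gcongr with j _
        rw [← Finset.sum_filter, Finset.sum_const, nsmul_eq_mul]
        gcongr
        exact hcol j
    _ = _ := by rw [← Finset.mul_sum]; ring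

/-- The root has norm at most `√s (1 + 1)`, and the covariance at most its square; hence the later
choice `s = τ / 4`. -/
theorem patternCov_mem_covClass (hs : 0 ≤ s) (hN : spectralNorm (patternMatrix K ε θ) ≤ 1) :
    patternCov K ε s θ ∈ covClass p (4 * s) := by
  have hA : ‖Matrix.toEuclideanCLM (n := Fin p) (𝕜 := ℝ) (patternRoot K ε s θ)‖ ≤
      2 * Real.sqrt s := by
    rw [patternRoot, map_smul, map_add, map_one, norm_smul, Real.norm_of_nonneg (Real.sqrt_nonneg s),
      mul_comm]
    gcongr
    refine (norm_add_le _ _).trans ?_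
    have := ContinuousLinearMap.norm_id_le (𝕜 := ℝ) (E := EuclideanSpace ℝ (Fin p))
    exact (add_le_add this hN).trans (by norm_num)
  change ‖Matrix.toEuclideanCLM (n := Fin p) (𝕜 := ℝ) (_ * _)‖ ≤ _
  rw [← Matrix.star_eq_conjTranspose, map_mul, map_star]
  refine (norm_mul_le _ _).trans ?_
  rw [ContinuousLinearMap.star_eq_adjoint, LinearIsometryEquiv.norm_map]
  calc _ ≤ (2 * Real.sqrt s) * (2 * Real.sqrt s) := by gcongr
    _ = 4 * s := by nlinarith [Real.mul_self_sqrt hs]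

theorem sum_sq_le_frobSq (A : Matrix (Fin p) (Fin p) ℝ) (K : Finset (Fin p × Fin p)) :
    ∑ e ∈ K, A e.1 e.2 ^ 2 ≤ frobSq A := by
  rw [frobSq, ← Fintype.sum_prod_type' fun i j => A i j ^ 2]
  exact Finset.sum_le_sum_of_subset_of_nonneg (Finset.subset_univ K) fun _ _ _ => sq_nonneg _

/-- Assouad's lemma for the pattern covariances and randomized estimators. -/
theorem assouad_patternCov {n : ℕ} (hK : ∀ i j k, (i, j) ∈ K → (j, k) ∉ K) (hs : 0 ≤ s)
    (hε : n * ε ^ 2 ≤ 1) (κ : Kernel (Data n p) (Matrix (Fin p) (Fin p) ℝ)) [IsMarkovKernel κ] :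
    ENNReal.ofReal (K.card * (s ^ 2 * ε ^ 2 / 12)) ≤
      ⨆ θ, ∫⁻ x, ∫⁻ S, ENNReal.ofReal (frobSq (S - (patternCov K ε s θ).1)) ∂(κ x)
        ∂(sampleLaw n p (patternCov K ε s θ).1) := by
  have hent : ∀ i j, Measurable fun S : Matrix (Fin p) (Fin p) ℝ => S i j := fun i j =>
    (measurable_pi_apply j).comp (measurable_pi_apply i)
  -- The part of the loss due to entry `e`, averaged over the randomization of the estimator.
  set G : Fin p × Fin p → (Fin p × Fin p → Bool) → Data n p → ℝ≥0∞ := fun e θ x =>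
    ∫⁻ S, ENNReal.ofReal ((S e.1 e.2 - s * patternMatrix K ε θ e.1 e.2) ^ 2) ∂(κ x) with hG
  have hloss : ∀ (e : Fin p × Fin p) θ, Measurable fun S : Matrix (Fin p) (Fin p) ℝ =>
      ENNReal.ofReal ((S e.1 e.2 - s * patternMatrix K ε θ e.1 e.2) ^ 2) := fun e θ =>
    (((hent e.1 e.2).sub_const _).pow_const 2).ennreal_ofReal
  have hGm : ∀ e θ, Measurable (G e θ) := fun e θ => (hloss e θ).lintegral_kernel
  set P : (Fin p × Fin p → Bool) → Measure (Data n p) := fun θ =>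
    sampleLaw n p (patternCov K ε s θ).1 with hP
  -- The targets differ by `s ε` at `e`, and `u² + (u ± s ε)² ≥ s² ε² / 2`; the testing factor `1/3`
  -- gives `1/6`.
  have hpair : ∀ e ∈ K, ∀ θ, ENNReal.ofReal (s ^ 2 * ε ^ 2 / 6) ≤
      ∫⁻ x, G e θ x ∂(P θ) + ∫⁻ x, G e (flipAt e θ) x ∂(P (flipAt e θ)) := by
    rintro ⟨i, j⟩ he θ
    have hij : i ≠ j := by rintro rfl; exact hK _ _ _ he he
    have hsep : ∀ x, ENNReal.ofReal (s ^ 2 * ε ^ 2 / 2) ≤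
        G (i, j) θ x + G (i, j) (flipAt (i, j) θ) x := by
      intro x
      simp only [hG]
      rw [← lintegral_add_left (hloss (i, j) θ)]
      calc ENNReal.ofReal (s ^ 2 * ε ^ 2 / 2)
          = ∫⁻ _, ENNReal.ofReal (s ^ 2 * ε ^ 2 / 2) ∂(κ x) := by simp
        _ ≤ _ := lintegral_mono fun S => by
          rw [← ENNReal.ofReal_add (sq_nonneg _) (sq_nonneg _)]
          refine ENNReal.ofReal_le_ofReal ?_
          simp only [patternMatrix_flipAt he, Matrix.add_apply, Matrix.single_apply_same]
          set u := S i j - s * patternMatrix K ε θ i j with hu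
          split_ifs
          · have : S i j - s * (patternMatrix K ε θ i j + -ε) = u + s * ε := by rw [hu]; ring
            rw [this]
            nlinarith [sq_nonneg (2 * u + s * ε)]
          · have : S i j - s * (patternMatrix K ε θ i j + ε) = u - s * ε := by rw [hu]; ring
            rw [this]
            nlinarith [sq_nonneg (2 * u - s * ε)]
    have hδ : (n : ℝ) * (if θ (i, j) then -ε else ε) ^ 2 ≤ 1 := by
      split_ifs
      · rwa [neg_sq]
      · exact hε
    have := two_point_bound_sampleLaw (patternRoot K ε s θ) hij hδ (hGm (i, j) θ)
      (hGm (i, j) (flipAt (i, j) θ)) hsep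
    rw [← patternRoot_flipAt hK he, ← ENNReal.ofReal_mul (by positivity)] at this
    refine le_trans (le_of_eq ?_) this
    congr 1
    ring
  have hsum : ∀ θ, ∑ e ∈ K, ∫⁻ x, G e θ x ∂(P θ) ≤
      ∫⁻ x, ∫⁻ S, ENNReal.ofReal (frobSq (S - (patternCov K ε s θ).1)) ∂(κ x) ∂(P θ) := by
    intro θ
    rw [← lintegral_finsetSum _ fun e _ => hGm e θ]
    refine lintegral_mono fun x => ?_
    simp only [hG]
    rw [← lintegral_finsetSum _ fun e _ => hloss e θ]
    refine lintegral_mono fun S => ?_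
    simp only
    rw [← ENNReal.ofReal_sum_of_nonneg fun _ _ => sq_nonneg _]
    refine ENNReal.ofReal_le_ofReal (le_trans (le_of_eq ?_) (sum_sq_le_frobSq _ K))
    refine Finset.sum_congr rfl fun e he => ?_
    rw [Matrix.sub_apply, patternCov_apply hK hs he]
  -- Flipping bit `e` permutes the hypercube, so each risk occurs twice in the sum over pairs. This
  -- factor `2` turns `1/6` into `1/12`.
  have havg : ∀ e ∈ K, (Fintype.card (Fin p × Fin p → Bool) : ℝ≥0∞) *
      ENNReal.ofReal (s ^ 2 * ε ^ 2 / 6) ≤ 2 * ∑ θ, ∫⁻ x, G e θ x ∂(P θ) := by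
    intro e he
    have hflip : ∑ θ, ∫⁻ x, G e (flipAt e θ) x ∂(P (flipAt e θ)) = ∑ θ, ∫⁻ x, G e θ x ∂(P θ) :=
      (Equiv.sum_comp (flipAt_involutive e).toPerm fun θ => ∫⁻ x, G e θ x ∂(P θ))
    calc _ = ∑ _θ : Fin p × Fin p → Bool, ENNReal.ofReal (s ^ 2 * ε ^ 2 / 6) := by simp
      _ ≤ ∑ θ, (∫⁻ x, G e θ x ∂(P θ) + ∫⁻ x, G e (flipAt e θ) x ∂(P (flipAt e θ))) :=
        Finset.sum_le_sum fun θ _ => hpair e he θ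
      _ = _ := by rw [Finset.sum_add_distrib, hflip, two_mul]
  set M := ⨆ θ, ∫⁻ x, ∫⁻ S, ENNReal.ofReal (frobSq (S - (patternCov K ε s θ).1)) ∂(κ x) ∂(P θ)
  set c : ℝ≥0∞ := (Fintype.card (Fin p × Fin p → Bool) : ℝ≥0∞)
  have hc0 : c ≠ 0 := by simp [c]
  have hct : c ≠ ∞ := ENNReal.natCast_ne_top _
  have hmain : c * (K.card * ENNReal.ofReal (s ^ 2 * ε ^ 2 / 6)) ≤ c * (2 * M) := by
    calc c * (K.card * ENNReal.ofReal (s ^ 2 * ε ^ 2 / 6))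
        = ∑ _e ∈ K, c * ENNReal.ofReal (s ^ 2 * ε ^ 2 / 6) := by
          rw [Finset.sum_const, nsmul_eq_mul]; ring
      _ ≤ ∑ e ∈ K, 2 * ∑ θ, ∫⁻ x, G e θ x ∂(P θ) := Finset.sum_le_sum havg
      _ = 2 * ∑ θ, ∑ e ∈ K, ∫⁻ x, G e θ x ∂(P θ) := by rw [← Finset.mul_sum, Finset.sum_comm]
      _ ≤ 2 * ∑ _θ : Fin p × Fin p → Bool, M := by
          gcongr with θ _
          exact (hsum θ).trans (le_iSup (fun θ => ∫⁻ x, ∫⁻ S,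
            ENNReal.ofReal (frobSq (S - (patternCov K ε s θ).1)) ∂(κ x) ∂(P θ)) θ)
      _ = c * (2 * M) := by
          rw [Finset.sum_const, nsmul_eq_mul, Finset.card_univ]; ring
  rw [ENNReal.mul_le_mul_iff_right hc0 hct] at hmain
  have h2 : (2 : ℝ≥0∞) * ENNReal.ofReal (K.card * (s ^ 2 * ε ^ 2 / 12)) =
      K.card * ENNReal.ofReal (s ^ 2 * ε ^ 2 / 6) := by
    rw [← ENNReal.ofReal_natCast K.card, ← ENNReal.ofReal_ofNat 2,
      ← ENNReal.ofReal_mul (by positivity), ← ENNReal.ofReal_mul (by positivity)]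
    congr 1
    ring
  rw [← h2, ENNReal.mul_le_mul_iff_right (by simp) (by simp)] at hmain
  exact hmain

end Pattern

/-! ### The band of free positions and its size. -/

/-- A band of width `m` in the lower left block of a matrix whose upper left block has size `a`. -/
def band (p a m : ℕ) : Finset (Fin p × Fin p) :=
  Finset.univ.filter fun e => e.2.1 < a ∧ a + e.2.1 ≤ e.1.1 ∧ e.1.1 < a + e.2.1 + m

theorem mem_band {p a m : ℕ} {i j : Fin p} :
    (i, j) ∈ band p a m ↔ j.1 < a ∧ a + j.1 ≤ i.1 ∧ i.1 < a + j.1 + m := by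
  simp [band]

/-- Columns in the band have index below `a`, rows index at least `a`. -/
theorem band_bipartite {p a m : ℕ} (i j k : Fin p) (h : (i, j) ∈ band p a m) :
    (j, k) ∉ band p a m := by
  rw [mem_band] at h ⊢
  omega

theorem card_band_row_le {p a m : ℕ} (i : Fin p) :
    (Finset.univ.filter fun j => (i, j) ∈ band p a m).card ≤ m := by
  -- Membership forces `a ≤ i`, so `i - a` is exact there; truncation at `0` of the lower end loses
  -- no column.
  calc _ ≤ (Finset.Ico (i.1 - a + 1 - m) (i.1 - a + 1)).card := by
        refine Finset.card_le_card_of_injOn (fun j : Fin p => j.1) (fun j hj => ?_)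
          Fin.val_injective.injOn
        have := mem_band.1 (Finset.mem_filter.1 hj).2
        rw [Finset.mem_coe, Finset.mem_Ico]
        dsimp only
        omega
    _ ≤ m := by rw [Nat.card_Ico]; omega

theorem card_band_col_le {p a m : ℕ} (j : Fin p) :
    (Finset.univ.filter fun i => (i, j) ∈ band p a m).card ≤ m := by
  calc _ ≤ (Finset.Ico (a + j.1) (a + j.1 + m)).card := by
        refine Finset.card_le_card_of_injOn (fun i : Fin p => i.1) (fun i hi => ?_)
          Fin.val_injective.injOn
        have := mem_band.1 (Finset.mem_filter.1 hi).2
        rw [Finset.mem_coe, Finset.mem_Ico]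
        dsimp only
        omega
    _ ≤ m := by rw [Nat.card_Ico]; omega

/-- The largest row index used is `2 a + m - 2 < p`, so none of the `a` columns of the band is cut
off at the edge. -/
theorem le_card_band {p a m : ℕ} (h : 2 * a + m ≤ p) : a * m ≤ (band p a m).card := by
  have hc : (Finset.univ : Finset (Fin a × Fin m)).card = a * m := by simp
  rw [← hc]
  refine Finset.card_le_card_of_injOn
    (fun q => (⟨a + q.1.1 + q.2.1, by omega⟩, ⟨q.1.1, by omega⟩)) (fun q _ => ?_) ?_
  · rw [Finset.mem_coe, mem_band]
    simp only
    omega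
  · rintro ⟨u, v⟩ _ ⟨u', v'⟩ _ huv
    simp only [Prod.mk.injEq, Fin.mk.injEq] at huv
    ext <;> simp only <;> omega

/-! ### Choice of parameters and conclusion. -/

/-- The lower bound for all randomized estimators. -/
theorem le_iSup_risk {n p : ℕ} (hn : 1 ≤ n) (hp : 3 ≤ p) {τ : ℝ} (hτ : 0 < τ)
    (κ : Kernel (Data n p) (Matrix (Fin p) (Fin p) ℝ)) [IsMarkovKernel κ] :
    ENNReal.ofReal (1 / 5000 * τ ^ 2 * ((p : ℝ) / (n : ℝ)) * min (p : ℝ) (Real.sqrt (n : ℝ))) ≤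
      ⨆ S₀ ∈ covClass p τ, ∫⁻ x, ∫⁻ S, ENNReal.ofReal (frobSq (S - S₀.1)) ∂(κ x)
        ∂(sampleLaw n p S₀.1) := by
  have hn0 : (0 : ℝ) < n := by exact_mod_cast hn
  -- Here `m ≤ a ≤ p / 3` makes the band fit, `m ≤ √n` gives `m ε ≤ 1` for the spectral norm, and `n
  -- ε² = 1` exhausts the testing budget.
  set a := p / 3 with ha
  set m := min a (Nat.sqrt n) with hm
  set ε := (Real.sqrt n)⁻¹ with hε
  have hε2 : ε ^ 2 = (n : ℝ)⁻¹ := by rw [hε, inv_pow, Real.sq_sqrt hn0.le]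
  have hmn : (m : ℝ) ≤ Real.sqrt n :=
    (Nat.cast_le.2 (min_le_right a (Nat.sqrt n))).trans Real.nat_sqrt_le_real_sqrt
  have hN : ∀ θ, spectralNorm (patternMatrix (band p a m) ε θ) ≤ 1 := fun θ =>
    (spectralNorm_patternMatrix_le (by positivity) card_band_row_le card_band_col_le).trans
      (by rw [hε, ← div_eq_mul_inv]; exact div_le_one_of_le₀ hmn (Real.sqrt_nonneg _))
  have hass := assouad_patternCov (K := band p a m) (ε := ε) (s := τ / 4) band_bipartite
    (by positivity) (by rw [hε2, mul_inv_cancel₀ hn0.ne']) κ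
  refine le_trans (ENNReal.ofReal_le_ofReal ?_) (hass.trans (iSup_le fun θ => ?_))
  · have hcard : (a : ℝ) * m ≤ (band p a m).card := by
      exact_mod_cast le_card_band (p := p) (a := a) (m := m) (by omega)
    -- Rounding down `p / 3` is worst at `p = 5`, where `a = 1`; this is the source of the factor
    -- `1/5`.
    have hap : (p : ℝ) / 5 ≤ a := by
      have : p ≤ 5 * a := by omega
      have : (p : ℝ) ≤ 5 * a := by exact_mod_cast this
      linarith
    have hsq : Real.sqrt n / 5 ≤ Nat.sqrt n := by
      have h1 : Real.sqrt n ≤ Nat.sqrt n + 1 := Real.real_sqrt_le_nat_sqrt_succ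
      have h2 : (1 : ℝ) ≤ Nat.sqrt n := by exact_mod_cast Nat.sqrt_pos.2 hn
      linarith
    have hmm : min (p : ℝ) (Real.sqrt n) / 5 ≤ m := by
      rw [hm, Nat.cast_min]
      refine le_min (le_trans ?_ hap) (le_trans ?_ hsq)
      · gcongr; exact min_le_left _ _
      · gcongr; exact min_le_right _ _
    have hmin : 0 ≤ min (p : ℝ) (Real.sqrt n) := by positivity
    have hprod : (p : ℝ) / 5 * (min (p : ℝ) (Real.sqrt n) / 5) ≤ (band p a m).card :=
      (mul_le_mul hap hmm (by positivity) (by positivity)).trans hcard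
    rw [hε2]
    -- The constant is `1/5000 = 1/25 · 1/200`, with `1/200` below `1/16 · 1/12 = 1/192`.
    calc 1 / 5000 * τ ^ 2 * ((p : ℝ) / n) * min (p : ℝ) (Real.sqrt n)
        = (p : ℝ) / 5 * (min (p : ℝ) (Real.sqrt n) / 5) * (τ ^ 2 * (n : ℝ)⁻¹ / 200) := by ring
      _ ≤ (band p a m).card * ((τ / 4) ^ 2 * (n : ℝ)⁻¹ / 12) := by
        refine mul_le_mul hprod ?_ (by positivity) (by positivity)
        have : 0 < τ ^ 2 * (n : ℝ)⁻¹ := by positivity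
        linarith
  · refine le_iSup₂_of_le (patternCov (band p a m) ε (τ / 4) θ) ?_ le_rfl
    have := patternCov_mem_covClass (s := τ / 4) (by positivity) (hN θ)
    rwa [mul_div_cancel₀ τ four_ne_zero] at this

theorem measurable_frobSq_sub {p : ℕ} (A : Matrix (Fin p) (Fin p) ℝ) :
    Measurable fun S : Matrix (Fin p) (Fin p) ℝ => ENNReal.ofReal (frobSq (S - A)) := by
  have h : ∀ i j, Measurable fun S : Matrix (Fin p) (Fin p) ℝ => (S i j - A i j) ^ 2 :=
    fun i j =>
      have hij : Measurable fun S : Matrix (Fin p) (Fin p) ℝ => S i j :=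
        (measurable_pi_apply j).comp (measurable_pi_apply i)
      (hij.sub_const (A i j)).pow_const 2
  exact (Finset.measurable_sum _ fun i _ =>
    Finset.measurable_sum _ fun j _ => h i j).ennreal_ofReal

end CovMinimax


theorem theorem2 :
    ∃ c : ℝ, 0 < c ∧
      ∀ p : ℕ → ℕ, Tendsto p atTop atTop →
      ∀ τ : ℕ → ℝ, (∀ n, 0 < τ n) →
      ∀ᶠ n : ℕ in atTop,
        ENNReal.ofReal (c * τ n ^ 2 * ((p n : ℝ) / (n : ℝ)) * min (p n : ℝ) (Real.sqrt (n : ℝ))) ≤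
            CovMinimax.bayesMinimaxRisk n (p n) (τ n) ∧
        ENNReal.ofReal (c * τ n ^ 2 * ((p n : ℝ) / (n : ℝ)) * min (p n : ℝ) (Real.sqrt (n : ℝ))) ≤
            CovMinimax.freqMinimaxRisk n (p n) (τ n) := by
  refine ⟨1 / 5000, by norm_num, fun p hp τ hτ => ?_⟩
  filter_upwards [hp.eventually_ge_atTop 3, eventually_ge_atTop 1] with n hpn hn
  constructor
  -- The posterior, pushed forward from covariance matrices to all matrices, is a randomized
  -- estimator with the same risk.
  · refine le_iInf fun π => le_iInf fun κ => le_iInf fun hκ => ?_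
    have := hκ.isMarkov
    have hval : Measurable (Subtype.val : CovMinimax.Cov (p n) → _) := measurable_subtype_coe
    have : IsMarkovKernel (κ.map Subtype.val) := Kernel.IsMarkovKernel.map κ hval
    refine (CovMinimax.le_iSup_risk hn hpn (hτ n) (κ.map Subtype.val)).trans (le_of_eq ?_)
    refine iSup_congr fun S₀ => iSup_congr fun _ => lintegral_congr fun x => ?_
    rw [Kernel.map_apply _ hval, lintegral_map (CovMinimax.measurable_frobSq_sub _) hval]
  -- An estimator is the kernel of point masses at its values.
  · refine le_iInf fun T => le_iInf fun hT => ?_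
    refine (CovMinimax.le_iSup_risk hn hpn (hτ n) (Kernel.deterministic T hT)).trans (le_of_eq ?_)
    refine iSup_congr fun S₀ => iSup_congr fun _ => lintegral_congr fun x => ?_
    rw [Kernel.lintegral_deterministic' hT (CovMinimax.measurable_frobSq_sub _)]
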